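/- **Setting.** A clause is a finite set of literals, a CNF formula a finite set of clauses, and an assignment a finite set of single-variable assignments. $V(\cdot)$ denotes the set of variables of a clause or formula and $\mathrm{Vars}(q)$ the set of variables assigned by $q$. The cofactor $F_q$ is obtained from $F$ by removing the clauses satisfied by $q$ and, from the other clauses, the literals falsified by $q$. Two clauses are resolvable on $v$ if $v$ is the only variable of which they have opposite literals; $v$ is blocked in a formula if no two of its clauses are resolvable on $v$. A D-sequent $s\to\{x\}$ consists of an assignment $s$ and a variable $x\in X$; it is active at $q$ if $s\subseteq q$. **Modified DDS for $\exists X[F]$, $X\subseteq V(F)$.** The algorithm maintains the current formula $F$, the set $\Pi$ of all D-sequents derived so far, and a set $\Omega$ of active D-sequents, at most one per variable; a variable with a D-sequent in $\Omega$, and every clause of $F_q$ containing such a variable, is called redundant. It starts with $q=\emptyset$, $\Pi=\Omega=\emptyset$. Every D-sequent that is derived is kept in $\Pi$. A call at $q$ creates one node of the search tree and does the following. 1. Each $x\in X\setminus\mathrm{Vars}(q)$ without a D-sequent in $\Omega$ for which $\Pi$ contains an active D-sequent gets such a D-sequent. 2. If some clause $C$ of $F$ is falsified by $q$, each remaining $x\in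 X\setminus\mathrm{Vars}(q)$ gets the D-sequent $s\to\{x\}$, where $s$ is the shortest assignment falsifying $C$; the node is a leaf. 3. Otherwise, as long as some $x\in X\setminus \mathrm{Vars}(q)$ without a D-sequent in $\Omega$ is blocked in $F_q$ without its redundant clauses, it gets an atomic D-sequent $s\to\{x\}$, where $s$ is the union, over all pairs $A,B$ of clauses of $F$ resolvable on $x$, of a single assignment of $q$ satisfying $A$ or $B$, or of the assignment $r$ of a D-sequent $r\to\{x'\}$ of $\Omega$ with $x'\in V(A)\cup V(B)$. If then every variable of $X\setminus\mathrm{Vars}(q)$ has a D-sequent in $\Omega$, the node is a leaf. 4. Otherwise a branching variable $v$ is picked. Candidates are the unassigned non-detached variables of $V(F)\setminus X$ ($y$ is detached if every clause of $F_q$ that contains $y$ and a variable of $X$ is redundant) and, if there are none, the unassigned non-redundant variables of $X$. If some candidate occurs in a unit clause of $F_q$, such a candidate must be picked, and the value falsifying the unit clause is explored first. Otherwise ($v$ is a decision branching variable) any candidate and any first value may be chosen. 5. The first branch $q_0=q\cup\{v=b\}$ is explored recursively. In what follows an assignment is called unsatisfiable if it falsifies a clause of the current formula, and satisfiable otherwise.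 If no D-sequent of $\Omega$ depends on $v$ and either $q_0$ is satisfiable or $q$ is unsatisfiable, the second branch is skipped. Otherwise the D-sequents depending on $v$ are removed from $\Omega$ and the second branch $q_1=q\cup\{v=\neg b\}$ is explored recursively. 6. If both branches were explored and both $q_0$ and $q_1$ are unsatisfiable, clauses $C_0,C_1$ of $F$ falsified by $q_0$ and $q_1$ are resolved on $v$ (if one of them does not contain $v$, it is taken as the result itself), the result $C$ is added to $F$, the D-sequents depending on $v$ are removed from $\Omega$, and the variables of $X\setminus\mathrm{Vars}(q)$ without a D-sequent get one from $C$ as in 2. If both branches were explored and $q_0$ or $q_1$ is satisfiable, then for each $x \in X\setminus\mathrm{Vars}(q_0)$ whose D-sequents in the two branches are $s_0\to\{x\}$ and $s_1\to\{x\}$: if $s_0$ assigns $v$, and $s_1$ assigns $v$ or $q_0$ is satisfiable, they are joined into $s\to\{x\}$, where $s$ consists of all assignments of $s_0$ and $s_1$ but those to $v$; otherwise $s_1\to\{x\}$ is kept. In this case, if $v\in X$, an atomic D-sequent for $v$ is then built at $q$ as in 3. If the second branch was skipped and $v\in X$, $v$ gets a D-sequent as in 2 if $q$ is unsatisfiable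 (together with any other variable that has none), and as in 3 otherwise. **Proposition (compositionality of DDS).** Let $F=F_1\wedge\dots\wedge F_k$ be a CNF formula with $V(F)\ne\emptyset$ and $V(F_i)\cap V(F_j)=\emptyset$ for $i\ne j$, let $X\subseteq V(F)$, and put $X_i=X\cap V(F_i)$ and $Y_i=V(F_i)\setminus X$. Then every search tree that the modified DDS can build for $\exists X[F]$, no matter how the decision branching variables (and all other free choices above) are chosen, has at most $$|V(F)|\cdot\sum_{i=1}^k 2\cdot 3^{|X_i\cup Y_i|}\cdot(|X_i|+1)$$ nodes, leaves included. -/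

import Mathlib

namespace DDS

/-! ### Clauses, assignments, cofactors

A pair `(v, b)` is read as the literal of `v` that is true exactly when `v = b`, and also as the
single-variable assignment `v = b`. A clause is a finite set of literals, a CNF formula is a finite
set of clauses, and a (partial) assignment is a finite set of single-variable assignments. -/

abbrev Clause (V : Type*) := Finset (V × Bool)

abbrev CNF (V : Type*) := Finset (Clause V)

abbrev Assignment (V : Type*) := Finset (V × Bool)

section Basic

variable {V : Type*} [DecidableEq V]

/-- The variables of a clause, or the variables assigned by an assignment. -/
def vars (S : Finset (V × Bool)) : Finset V := S.image Prod.fst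

/-- The variables of a CNF formula. -/
def cnfVars (F : CNF V) : Finset V := F.biUnion vars

/-- The opposite literal. -/
def neg (l : V × Bool) : V × Bool := (l.1, !l.2)

/-- `q` satisfies the clause `C`. -/
abbrev Satisfied (C : Clause V) (q : Assignment V) : Prop := (C ∩ q).Nonempty

/-- The shortest assignment that falsifies the clause `C`. -/
def falsifier (C : Clause V) : Assignment V := C.image neg

/-- Some clause of `F` is falsified by `q`. -/
abbrev Conflict (F : CNF V) (q : Assignment V) : Prop := ∃ C ∈ F, falsifier C ⊆ q

/-- The cofactor of `F` under `q`: satisfied clauses are removed, and so are the literals that are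
falsified by `q` from the remaining clauses. -/
def cofactor (F : CNF V) (q : Assignment V) : CNF V :=
  (F.filter fun C => ¬ Satisfied C q).image fun C => C.filter fun l => neg l ∉ q

/-- The clauses of `F` that have no variable in `Z`. -/
def dropZ (F : CNF V) (Z : Finset V) : CNF V := F.filter fun C => Disjoint (vars C) Z

/-- `A` and `B` have opposite literals of exactly one variable, and this variable is `v`. -/
def Resolvable (A B : Clause V) (v : V) : Prop :=
  (∃ b, (v, b) ∈ A ∧ (v, !b) ∈ B) ∧ ∀ w b, (w, b) ∈ A → (w, !b) ∈ B → w = v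

/-- `v` is blocked in `F`: no two clauses of `F` can be resolved on `v`. -/
def Blocked (F : CNF V) (v : V) : Prop := ∀ A ∈ F, ∀ B ∈ F, ¬ Resolvable A B v

/-- All members of `A` and `B` but those on the variable `v`: the resolvent on `v` of two clauses,
respectively of two assignments. -/
def resolveAt (v : V) (A B : Finset (V × Bool)) : Finset (V × Bool) :=
  (A ∪ B).filter fun l => l.1 ≠ v

/-- The result `C` of resolving on `v` the clauses `C₀`, `C₁` falsified in the two branches of `v`.
If one of them does not depend on `v`, it is returned itself. -/
def ResolveClauses (C₀ C₁ : Clause V) (v : V) (C : Clause V) : Prop :=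
  (v ∉ vars C₀ ∧ C = C₀) ∨ (v ∉ vars C₁ ∧ C = C₁) ∨
    (v ∈ vars C₀ ∧ v ∈ vars C₁ ∧ C = resolveAt v C₀ C₁)

end Basic

/-! ### Sets of D-sequents

A single-variable D-sequent `s → {x}` is written `(s, x)`: in the subspace `s` the variable `x` is
redundant. It is active at `q` if `s ⊆ q`. -/

/-- The current set `Ω` of active D-sequents, at most one for each variable: `Ω x = some s` means
that it contains `s → {x}`, and `Ω x = none` that `x` is not (known to be) redundant. -/
abbrev Active (V : Type*) := V → Option (Assignment V)

/-- The global data of the algorithm: the current formula (with all the resolvents added so far),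
the set of all D-sequents derived so far, and the current set of active D-sequents. -/
structure State (V : Type*) where
  cnf : CNF V
  derived : Finset (Assignment V × V)
  active : Active V

section Algorithm

variable {V : Type*} [DecidableEq V]

/-- The variables of `X` stated to be redundant by `Ω`. -/
def redVars (X : Finset V) (Ω : Active V) : Finset V := X.filter fun x => (Ω x).isSome

/-- The cofactor of `F` under `q` without the clauses that have a redundant variable. -/
def current (X : Finset V) (F : CNF V) (q : Assignment V) (Ω : Active V) : CNF V :=
  dropZ (cofactor F q) (redVars X Ω)

/-- Adds the D-sequents of `Ω` to the set `D` of all derived D-sequents. -/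
def keep (X : Finset V) (D : Finset (Assignment V × V)) (Ω : Active V) :
    Finset (Assignment V × V) :=
  D ∪ X.biUnion fun x => (Ω x).toFinset.image fun s => (s, x)

/-- `Ω'` is `Ω` after reusing the stored D-sequents: an unassigned variable `x` of `X` without a
D-sequent is declared redundant as soon as some derived D-sequent for `x` is active at `q`. -/
def Reuse (X : Finset V) (q : Assignment V) (D : Finset (Assignment V × V)) (Ω Ω' : Active V) :
    Prop :=
  ∀ x, if x ∈ X \ vars q ∧ Ω x = none then
      (∃ s, (s, x) ∈ D ∧ s ⊆ q ∧ Ω' x = some s) ∨ ((∀ s, (s, x) ∈ D → ¬ s ⊆ q) ∧ Ω' x = none)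
    else Ω' x = Ω x

/-- `C` is a clause falsified by `q`: every unassigned variable of `X` that has no D-sequent yet
gets the D-sequent `s → {x}`, where `s` is the shortest assignment that falsifies `C`. -/
def processUnsat (X : Finset V) (q : Assignment V) (C : Clause V) (Ω : Active V) : Active V :=
  fun x => if x ∈ X \ vars q ∧ Ω x = none then some (falsifier C) else Ω x

/-- One reason `r` why the pair `A`, `B` does not matter at `q`: a single assignment of `q` that
satisfies `A` or `B`, or the assignment of the D-sequent of a redundant variable of `A` or `B`. -/
def PairReason (q : Assignment V) (Ω : Active V) (A B : Clause V) (r : Assignment V) : Prop :=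
  (∃ l ∈ A ∪ B, l ∈ q ∧ r = {l}) ∨ ∃ x ∈ vars A ∪ vars B, Ω x = some r

/-- `s` is the left-hand side of an atomic D-sequent for the variable `x` blocked at `q`: the union
of one reason for each pair of clauses of `F` that can be resolved on `x`. -/
def BlockedReason (F : CNF V) (q : Assignment V) (Ω : Active V) (x : V) (s : Assignment V) :
    Prop :=
  ∃ ρ : Clause V → Clause V → Assignment V,
    (∀ A ∈ F, ∀ B ∈ F, Resolvable A B x → PairReason q Ω A B (ρ A B)) ∧
    ∀ l, l ∈ s ↔ ∃ A ∈ F, ∃ B ∈ F, Resolvable A B x ∧ l ∈ ρ A B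

/-- One step of building atomic D-sequents of blocked variables. -/
def BlockedStep (X : Finset V) (F : CNF V) (q : Assignment V) (Ω Ω' : Active V) : Prop :=
  ∃ x ∈ X \ vars q, ∃ s, Ω x = none ∧ Blocked (current X F q Ω) x ∧ BlockedReason F q Ω x s ∧
    Ω' = Function.update Ω x (some s)

/-- Atomic D-sequents are built until every blocked unassigned variable of `X` has a D-sequent. -/
def BlockedPhase (X : Finset V) (F : CNF V) (q : Assignment V) (Ω Ω' : Active V) : Prop :=
  Relation.ReflTransGen (BlockedStep X F q) Ω Ω' ∧
    ∀ x ∈ X \ vars q, Blocked (current X F q Ω') x → Ω' x ≠ none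

/-- Every unassigned variable of `X` has a D-sequent. -/
def AllRedundant (X : Finset V) (q : Assignment V) (Ω : Active V) : Prop :=
  ∀ x ∈ X \ vars q, Ω x ≠ none

/-- `y` is detached: every clause of the cofactor with `y` and a variable of `X` is redundant. -/
def Detached (X : Finset V) (F : CNF V) (q : Assignment V) (Ω : Active V) (y : V) : Prop :=
  ∀ C ∈ cofactor F q, y ∈ vars C → (∃ x ∈ X, x ∈ vars C) → ∃ x ∈ redVars X Ω, x ∈ vars C

/-- A free non-detached variable that is not quantified. -/
def FreeY (X : Finset V) (F : CNF V) (q : Assignment V) (Ω : Active V) (y : V) : Prop :=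
  y ∈ cnfVars F \ X ∧ y ∉ vars q ∧ ¬ Detached X F q Ω y

/-- The variables one may branch on: free non-detached non-quantified variables and, once there are
none of these, free quantified variables that are not redundant. -/
def Candidate (X : Finset V) (F : CNF V) (q : Assignment V) (Ω : Active V) (v : V) : Prop :=
  FreeY X F q Ω v ∨ (v ∈ X \ vars q ∧ Ω v = none ∧ ∀ y, ¬ FreeY X F q Ω y)

/-- `v` may be picked for branching with `v = b` explored first. If some candidate occurs in a unit
clause of the cofactor, such a variable has to be picked and the value that falsifies the unit
clause is explored first; otherwise (decision variables) the choice is arbitrary. -/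
def Pick (X : Finset V) (F : CNF V) (q : Assignment V) (Ω : Active V) (v : V) (b : Bool) : Prop :=
  Candidate X F q Ω v ∧
    ((∃ u c, Candidate X F q Ω u ∧ {(u, c)} ∈ cofactor F q) → {(v, !b)} ∈ cofactor F q)

/-- No D-sequent of `Ω` depends on `v`. -/
def AllSymmetric (v : V) (Ω : Active V) : Prop := ∀ x s, Ω x = some s → v ∉ vars s

/-- Discards the D-sequents that depend on `v`. -/
def dropAsym (v : V) (Ω : Active V) : Active V :=
  fun x => (Ω x).filter fun s => decide (v ∉ vars s)

/-- Joins at `v` the D-sequents `Ω₀` of the first branch `q₀` with those `Ω₁` of the second branch.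
A D-sequent of the second branch replaces an asymmetric one of the first branch without a join only
if it is symmetric in `v` and the first branch is unsatisfiable. (If it is symmetric but the first
branch is satisfiable, the assignment to `v` is first added to it; the join removes it again.) -/
def joinDSeqs (F : CNF V) (q₀ : Assignment V) (v : V) (Ω₀ Ω₁ : Active V) : Active V :=
  fun x =>
    match Ω₀ x, Ω₁ x with
    | some s₀, some s₁ =>
        if v ∈ vars s₀ ∧ (v ∈ vars s₁ ∨ ¬ Conflict F q₀) then some (resolveAt v s₀ s₁)
        else some s₁
    | _, o => o

/-- If the branching variable `v` is quantified, the atomic D-sequent of `v` is added. -/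
def AddBranchVar (X : Finset V) (F : CNF V) (q : Assignment V) (v : V) (Ω Ω' : Active V) : Prop :=
  (v ∉ X ∧ Ω' = Ω) ∨
    (v ∈ X ∧ ∃ s, BlockedReason F q Ω v s ∧ Ω' = Function.update Ω v (some s))

/-- The results `Ω₀` of the first branch, all symmetric in `v`, are returned as those of `q`, with a
D-sequent for `v` itself if `v` is quantified. -/
def ReturnFirst (X : Finset V) (F : CNF V) (q : Assignment V) (v : V) (Ω Ω' : Active V) : Prop :=
  (∃ C ∈ F, falsifier C ⊆ q ∧ Ω' = processUnsat X q C Ω) ∨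
    (¬ Conflict F q ∧ AddBranchVar X F q v Ω Ω')

end Algorithm

/-! ### The search tree -/

/-- Search trees: `one v b t` is a node with branching variable `v` where only the branch `v = b`
was explored, `two v b t₀ t₁` one where `v = b` was explored first (`t₀`) and then `v = !b`. -/
inductive SearchTree (V : Type*)
  | leaf : SearchTree V
  | one (v : V) (b : Bool) (t : SearchTree V) : SearchTree V
  | two (v : V) (b : Bool) (t₀ t₁ : SearchTree V) : SearchTree V

/-- The number of nodes, leaves included. -/
def SearchTree.size {V : Type*} : SearchTree V → ℕ
  | .leaf => 1
  | .one _ _ t => t.size + 1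
  | .two _ _ t₀ t₁ => t₀.size + t₁.size + 1

/-- `Run X q σ T σ'`: a call for the set `X` of quantified variables at the assignment `q`, started
in the state `σ`, can build the search tree `T` and return in the state `σ'`. A node is
unsatisfiable if the formula at that time has a clause falsified by its assignment. -/
inductive Run {V : Type*} [DecidableEq V] (X : Finset V) :
    Assignment V → State V → SearchTree V → State V → Prop
  /-- A clause is falsified: leaf. -/
  | unsatLeaf (q : Assignment V) (F : CNF V) (D : Finset (Assignment V × V)) (Ω Ω₁ : Active V)
      (C : Clause V)
      (hreuse : Reuse X q D Ω Ω₁)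
      (hC : C ∈ F) (hfals : falsifier C ⊆ q) :
      Run X q ⟨F, D, Ω⟩ .leaf
        ⟨F, keep X D (processUnsat X q C Ω₁), processUnsat X q C Ω₁⟩
  /-- No clause is falsified and every unassigned quantified variable is redundant: leaf. -/
  | satLeaf (q : Assignment V) (F : CNF V) (D : Finset (Assignment V × V)) (Ω Ω₁ Ω₂ : Active V)
      (hreuse : Reuse X q D Ω Ω₁)
      (hno : ¬ Conflict F q)
      (hblocked : BlockedPhase X F q Ω₁ Ω₂)
      (hall : AllRedundant X q Ω₂) :
      Run X q ⟨F, D, Ω⟩ .leaf ⟨F, keep X D Ω₂, Ω₂⟩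
  /-- After the first branch all D-sequents are symmetric in the branching variable `v`, and the
  first branch is satisfiable or a clause without `v` shows that it is not: the second branch is
  not explored. -/
  | oneBranch (q : Assignment V) (F F₀ : CNF V) (D D₀ : Finset (Assignment V × V))
      (Ω Ω₁ Ω₂ Ω₃ Ω₄ : Active V) (v : V) (b : Bool) (t : SearchTree V)
      (hreuse : Reuse X q D Ω Ω₁)
      (hno : ¬ Conflict F q)
      (hblocked : BlockedPhase X F q Ω₁ Ω₂)
      (hall : ¬ AllRedundant X q Ω₂)
      (hpick : Pick X F q Ω₂ v b)
      (hfirst : Run X (insert (v, b) q) ⟨F, keep X D Ω₂, Ω₂⟩ t ⟨F₀, D₀, Ω₃⟩)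
      (hsym : AllSymmetric v Ω₃)
      (hskip : Conflict F₀ (insert (v, b) q) → Conflict F₀ q)
      (hret : ReturnFirst X F₀ q v Ω₃ Ω₄) :
      Run X q ⟨F, D, Ω⟩ (.one v b t) ⟨F₀, keep X D₀ Ω₄, Ω₄⟩
  /-- Both branches are explored and turn out to be unsatisfiable: the resolvent of two falsified
  clauses is added to the formula. -/
  | bothUnsat (q : Assignment V) (F F₀ F₁ : CNF V) (D D₀ D₁ : Finset (Assignment V × V))
      (Ω Ω₁ Ω₂ Ω₃ Ω₄ : Active V) (v : V) (b : Bool) (t₀ t₁ : SearchTree V)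
      (C₀ C₁ C : Clause V)
      (hreuse : Reuse X q D Ω Ω₁)
      (hno : ¬ Conflict F q)
      (hblocked : BlockedPhase X F q Ω₁ Ω₂)
      (hall : ¬ AllRedundant X q Ω₂)
      (hpick : Pick X F q Ω₂ v b)
      (hfirst : Run X (insert (v, b) q) ⟨F, keep X D Ω₂, Ω₂⟩ t₀ ⟨F₀, D₀, Ω₃⟩)
      (hcont : ¬ (AllSymmetric v Ω₃ ∧ (Conflict F₀ (insert (v, b) q) → Conflict F₀ q)))
      (hsecond : Run X (insert (v, !b) q) ⟨F₀, D₀, dropAsym v Ω₃⟩ t₁ ⟨F₁, D₁, Ω₄⟩)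
      (hC₀ : C₀ ∈ F₁) (hfals₀ : falsifier C₀ ⊆ insert (v, b) q)
      (hC₁ : C₁ ∈ F₁) (hfals₁ : falsifier C₁ ⊆ insert (v, !b) q)
      (hres : ResolveClauses C₀ C₁ v C) :
      Run X q ⟨F, D, Ω⟩ (.two v b t₀ t₁)
        ⟨insert C F₁, keep X D₁ (processUnsat X q C (dropAsym v Ω₄)),
          processUnsat X q C (dropAsym v Ω₄)⟩
  /-- Both branches are explored and at least one of them is satisfiable: the D-sequents are
  merged. -/
  | merge (q : Assignment V) (F F₀ F₁ : CNF V) (D D₀ D₁ : Finset (Assignment V × V))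
      (Ω Ω₁ Ω₂ Ω₃ Ω₄ Ω₅ : Active V) (v : V) (b : Bool) (t₀ t₁ : SearchTree V)
      (hreuse : Reuse X q D Ω Ω₁)
      (hno : ¬ Conflict F q)
      (hblocked : BlockedPhase X F q Ω₁ Ω₂)
      (hall : ¬ AllRedundant X q Ω₂)
      (hpick : Pick X F q Ω₂ v b)
      (hfirst : Run X (insert (v, b) q) ⟨F, keep X D Ω₂, Ω₂⟩ t₀ ⟨F₀, D₀, Ω₃⟩)
      (hcont : ¬ (AllSymmetric v Ω₃ ∧ (Conflict F₀ (insert (v, b) q) → Conflict F₀ q)))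
      (hsecond : Run X (insert (v, !b) q) ⟨F₀, D₀, dropAsym v Ω₃⟩ t₁ ⟨F₁, D₁, Ω₄⟩)
      (hsat : ¬ (Conflict F₁ (insert (v, b) q) ∧ Conflict F₁ (insert (v, !b) q)))
      (hadd : AddBranchVar X F₁ q v (joinDSeqs F₁ (insert (v, b) q) v Ω₃ Ω₄) Ω₅) :
      Run X q ⟨F, D, Ω⟩ (.two v b t₀ t₁) ⟨F₁, keep X D₁ Ω₅, Ω₅⟩

/-- `T` is a search tree built for the quantifier elimination problem `∃ X [F]`: the algorithm is
called with the empty assignment, no active D-sequents, and nothing derived so far. -/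
def IsSearchTree {V : Type*} [DecidableEq V] (X : Finset V) (F : CNF V) (T : SearchTree V) : Prop :=
  ∃ σ : State V, Run X ∅ ⟨F, ∅, fun _ => none⟩ T σ

end DDS

/-!
Call an item a clause that is not a tautology, or a derived D-sequent `s → {x}` that is local: `s`
assigns only variables of the component `cnfVars (F i)` that contains `x`. With `nᵢ` variables in
this component, `mᵢ` of them quantified, there are at most `3 ^ nᵢ` clauses over it that are not
tautologies and at most `3 ^ nᵢ * mᵢ` local D-sequents (`numItems_lt_sum`).

A call that branches always produces a new item (`numItems_lt`). When it starts to branch, no clause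
is falsified at `q`, and some quantified `x` has no derived D-sequent that is active at `q`. When it
returns, either some clause is falsified at `q`, and this clause is new, or `x` has a D-sequent
active at `q`, and this D-sequent is new. It is local, since every D-sequent is either local or the
shortest assignment falsifying a clause (`Origin`), and the latter is not active at `q` when `q`
falsifies no clause. That joins and atomic D-sequents preserve this dichotomy is the content of
`isLocal_resolveAt` and `BlockedReason.isLocal`.

The calls that contain the creation of a given item are on one path of the search tree, and so there
are at most as many of them that branch as there are variables. Hence the number of inner nodes is
at most the number of variables times the number of items (`Run.inner_add_le`, where the potential
is the number of unassigned variables times the number of items). The number of leaves exceeds that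
of the inner nodes by at most one, whence the factor two. The additional leaf is paid for by an item
that never occurs: no D-sequent assigns its own variable. The order of branching plays no role.
-/

namespace DDS

/-! ### Literals, falsified clauses and consistent assignments -/

section Basic

variable {V : Type*} [DecidableEq V]

theorem mem_vars {S : Finset (V × Bool)} {v : V} : v ∈ vars S ↔ ∃ b, (v, b) ∈ S := by
  simp [vars]

theorem vars_mono {S T : Finset (V × Bool)} (h : S ⊆ T) : vars S ⊆ vars T :=
  Finset.image_subset_image h

theorem vars_insert (v : V) (b : Bool) (q : Assignment V) :
    vars (insert (v, b) q) = insert v (vars q) := by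
  simp [vars]

theorem mem_falsifier {C : Clause V} {v : V} {b : Bool} :
    (v, b) ∈ falsifier C ↔ (v, !b) ∈ C := by
  simp only [falsifier, neg, Finset.mem_image, Prod.exists, Prod.mk.injEq]
  constructor
  · rintro ⟨a, c, h, rfl, rfl⟩
    simpa using h
  · intro h
    exact ⟨v, !b, h, rfl, by simp⟩

theorem vars_falsifier (C : Clause V) : vars (falsifier C) = vars C := by
  simp [vars, falsifier, Finset.image_image, Function.comp_def, neg]

theorem vars_subset_cnfVars {F : CNF V} {C : Clause V} (h : C ∈ F) : vars C ⊆ cnfVars F :=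
  Finset.subset_biUnion_of_mem vars h

theorem falsifier_resolveAt (v : V) (A B : Clause V) :
    falsifier (resolveAt v A B) = resolveAt v (falsifier A) (falsifier B) := by
  ext ⟨w, c⟩
  simp [mem_falsifier, resolveAt]

theorem subset_of_subset_insert {v : V} {b : Bool} {q s : Assignment V}
    (h : s ⊆ insert (v, b) q) (hv : v ∉ vars s) : s ⊆ q := by
  rintro ⟨w, c⟩ hl
  rcases Finset.mem_insert.1 (h hl) with e | e
  · obtain ⟨rfl, rfl⟩ := Prod.mk.inj e
    exact absurd (mem_vars.2 ⟨_, hl⟩) hv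
  · exact e

theorem resolveAt_subset {v : V} {b c : Bool} {q s₀ s₁ : Assignment V}
    (h₀ : s₀ ⊆ insert (v, b) q) (h₁ : s₁ ⊆ insert (v, c) q) : resolveAt v s₀ s₁ ⊆ q := by
  intro l hl
  obtain ⟨hl, hv⟩ := Finset.mem_filter.1 hl
  have aux : ∀ d, l ∈ insert (v, d) q → l ∈ q := fun d h =>
    (Finset.mem_insert.1 h).resolve_left fun e => hv (by rw [e])
  rcases Finset.mem_union.1 hl with h | h
  exacts [aux b (h₀ h), aux c (h₁ h)]

theorem Conflict.mono {F F' : CNF V} {q q' : Assignment V} (h : Conflict F q) (hF : F ⊆ F')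
    (hq : q ⊆ q') : Conflict F' q' :=
  let ⟨C, hC, hf⟩ := h
  ⟨C, hF hC, hf.trans hq⟩

/-- A set of literals without opposite literals: a consistent assignment, or a clause that is not
a tautology. -/
def Functional (S : Finset (V × Bool)) : Prop := ∀ v b, (v, b) ∈ S → (v, !b) ∉ S

theorem Functional.mono {V : Type*} {S T : Finset (V × Bool)} (hT : Functional T) (h : S ⊆ T) :
    Functional S :=
  fun v b hv hv' => hT v b (h hv) (h hv')

theorem Functional.insert_of_notMem {q : Assignment V} (hq : Functional q) {v : V} (hv : v ∉ vars q)
    (b : Bool) : Functional (insert (v, b) q) := by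
  have hv' : ∀ c, (v, c) ∉ q := fun c h => hv (mem_vars.2 ⟨c, h⟩)
  intro w c h h'
  simp only [Finset.mem_insert, Prod.mk.injEq] at h h'
  rcases h with ⟨rfl, rfl⟩ | h
  · rcases h' with ⟨-, e⟩ | h'
    · simp at e
    · exact hv' _ h'
  · rcases h' with ⟨rfl, -⟩ | h'
    · exact hv' _ h
    · exact hq _ _ h h'

theorem functional_of_falsifier_subset {C : Clause V} {q : Assignment V} (hq : Functional q)
    (h : falsifier C ⊆ q) : Functional C := fun v b hb hb' =>
  hq v b (h (mem_falsifier.2 hb')) (h (mem_falsifier.2 (by simpa using hb)))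

open Classical in
/-- The sets of literals over `W` without opposite literals. -/
noncomputable def functionalSets (W : Finset V) : Finset (Finset (V × Bool)) :=
  (W ×ˢ Finset.univ).powerset.filter Functional

theorem mem_functionalSets {W : Finset V} {S : Finset (V × Bool)} :
    S ∈ functionalSets W ↔ vars S ⊆ W ∧ Functional S := by
  simp only [functionalSets, Finset.mem_filter, Finset.mem_powerset, and_congr_left_iff]
  intro _
  constructor
  · intro h v hv
    obtain ⟨b, hb⟩ := mem_vars.1 hv
    exact (Finset.mem_product.1 (h hb)).1
  · rintro h ⟨v, b⟩ hb
    exact Finset.mem_product.2 ⟨h (mem_vars.2 ⟨b, hb⟩), Finset.mem_univ _⟩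

theorem card_functionalSets_le (W : Finset V) : (functionalSets W).card ≤ 3 ^ W.card := by
  have hc : (Finset.pi W fun _ => (Finset.univ : Finset (Option Bool))).card = 3 ^ W.card := by
    simp [Finset.card_pi]
  rw [← hc]
  -- A member is coded by the function that gives each variable of `W` its polarity, if it has one.
  refine Finset.card_le_card_of_injOn
    (fun S v _ => if (v, true) ∈ S then some true else if (v, false) ∈ S then some false else none)
    (fun S _ => by simp) ?_
  intro S hS T hT hST
  have hS' := mem_functionalSets.1 hS
  have hT' := mem_functionalSets.1 hT
  have key : ∀ v ∈ W, ∀ b, (v, b) ∈ S ↔ (v, b) ∈ T := by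
    intro v hv b
    have h := congrFun (congrFun hST v) hv
    have hs := hS'.2 v true
    have ht := hT'.2 v true
    simp only [Bool.not_true] at hs ht
    cases b <;> grind
  ext ⟨v, b⟩
  constructor
  · intro h
    exact (key v (hS'.1 (mem_vars.2 ⟨b, h⟩)) b).1 h
  · intro h
    exact (key v (hT'.1 (mem_vars.2 ⟨b, h⟩)) b).2 h

end Basic

/-! ### Local D-sequents and the invariant -/

section Invariant

variable {V ι : Type*} [DecidableEq V]

/-- `s → {x}` is local: `s` only assigns variables of the component of `x`. -/
def IsLocal (P : ι → Finset V) (s : Assignment V) (x : V) : Prop := ∃ i, x ∈ P i ∧ vars s ⊆ P i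

/-- `s → {x}` is local, or `s` is the shortest assignment that falsifies some clause of `F`. -/
def Origin (P : ι → Finset V) (F : CNF V) (s : Assignment V) (x : V) : Prop :=
  IsLocal P s x ∨ ∃ C ∈ F, falsifier C = s

theorem Origin.mono {P : ι → Finset V} {F F' : CNF V} {s : Assignment V} {x : V}
    (h : Origin P F s x) (hF : F ⊆ F') : Origin P F' s x :=
  h.imp_right fun ⟨C, hC, e⟩ => ⟨C, hF hC, e⟩

/-- The D-sequents that are not local are active only in subspaces with a falsified clause. -/
theorem Origin.isLocal {P : ι → Finset V} {F : CNF V} {s q : Assignment V} {x : V}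
    (h : Origin P F s x) (hs : s ⊆ q) (hq : ¬ Conflict F q) : IsLocal P s x :=
  h.resolve_right fun ⟨C, hC, e⟩ => hq ⟨C, hC, e ▸ hs⟩

/-- Every clause of `F` lies in one component. -/
def Split (P : ι → Finset V) (F : CNF V) : Prop := ∀ C ∈ F, ∃ i, vars C ⊆ P i

/-- What holds for every derived D-sequent `s → {x}`. -/
structure Proper (P : ι → Finset V) (X : Finset V) (F : CNF V) (s : Assignment V) (x : V) :
    Prop where
  mem : x ∈ X
  notMem_vars : x ∉ vars s
  functional : Functional s
  origin : Origin P F s x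

/-- What holds for the D-sequents of `Ω` at `q`: they are for unassigned variables of `X`, they are
active at `q`, and each is local or comes from a falsified clause. -/
def ActiveAt (P : ι → Finset V) (X : Finset V) (F : CNF V) (q : Assignment V) (Ω : Active V) :
    Prop :=
  ∀ x s, Ω x = some s → x ∈ X ∧ x ∉ vars q ∧ s ⊆ q ∧ Origin P F s x

/-- The invariant of the states at the beginning and at the end of a call at `q`. -/
structure Invariant (P : ι → Finset V) (X : Finset V) (q : Assignment V) (σ : State V) :
    Prop where
  split : Split P σ.cnf
  proper : ∀ s x, (s, x) ∈ σ.derived → Proper P X σ.cnf s x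
  activeAt : ActiveAt P X σ.cnf q σ.active

/-- Every D-sequent of `Ω` is one of `Ω'`. -/
def Extends (Ω Ω' : Active V) : Prop := ∀ x s, Ω x = some s → Ω' x = some s

variable {P : ι → Finset V} {X : Finset V} {F F' : CNF V} {q : Assignment V} {Ω Ω' : Active V}
  {D : Finset (Assignment V × V)}

theorem Extends.trans {V : Type*} {Ω Ω' Ω'' : Active V} (h : Extends Ω Ω') (h' : Extends Ω' Ω'') :
    Extends Ω Ω'' :=
  fun x s hs => h' x s (h x s hs)

theorem ActiveAt.mono (h : ActiveAt P X F q Ω) (hF : F ⊆ F') : ActiveAt P X F' q Ω :=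
  fun x s hs => let ⟨h₁, h₂, h₃, h₄⟩ := h x s hs; ⟨h₁, h₂, h₃, h₄.mono hF⟩

theorem Proper.mono {s : Assignment V} {x : V} (h : Proper P X F s x) (hF : F ⊆ F') :
    Proper P X F' s x :=
  ⟨h.mem, h.notMem_vars, h.functional, h.origin.mono hF⟩

theorem mem_keep {s : Assignment V} {x : V} :
    (s, x) ∈ keep X D Ω ↔ (s, x) ∈ D ∨ x ∈ X ∧ Ω x = some s := by
  simp only [keep, Finset.mem_union, Finset.mem_biUnion, Finset.mem_image, Option.mem_toFinset,
    Option.mem_def, Prod.mk.injEq]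
  constructor
  · rintro (h | ⟨y, hy, t, ht, rfl, rfl⟩)
    exacts [Or.inl h, Or.inr ⟨hy, ht⟩]
  · rintro (h | ⟨hx, hs⟩)
    exacts [Or.inl h, Or.inr ⟨x, hx, s, hs, rfl, rfl⟩]

theorem Invariant.of_keep (hq : Functional q) (hF : Split P F)
    (hD : ∀ s x, (s, x) ∈ D → Proper P X F s x) (hΩ : ActiveAt P X F q Ω) :
    Invariant P X q ⟨F, keep X D Ω, Ω⟩ where
  split := hF
  proper s x h := by
    rcases mem_keep.1 h with h | ⟨-, h⟩
    · exact hD s x h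
    · obtain ⟨h₁, h₂, h₃, h₄⟩ := hΩ x s h
      exact ⟨h₁, fun hx => h₂ (vars_mono h₃ hx), hq.mono h₃, h₄⟩
  activeAt := hΩ

theorem Reuse.extends (h : Reuse X q D Ω Ω') : Extends Ω Ω' := by
  intro x s hs
  have := h x
  rw [if_neg (by simp [hs])] at this
  rw [this, hs]

theorem Reuse.activeAt (h : Reuse X q D Ω Ω') (hΩ : ActiveAt P X F q Ω)
    (hD : ∀ s x, (s, x) ∈ D → Proper P X F s x) : ActiveAt P X F q Ω' := by
  intro x s hs
  have hx := h x
  split_ifs at hx with hc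
  · obtain ⟨hxX, hxq⟩ := Finset.mem_sdiff.1 hc.1
    rcases hx with ⟨t, ht, htq, e⟩ | ⟨-, e⟩
    · obtain rfl : t = s := Option.some.inj (e.symm.trans hs)
      exact ⟨hxX, hxq, htq, (hD _ _ ht).origin⟩
    · simp [e] at hs
  · exact hΩ x s (hx ▸ hs)

theorem extends_processUnsat (C : Clause V) : Extends Ω (processUnsat X q C Ω) := by
  intro x s hs
  simp [processUnsat, hs]

theorem allRedundant_processUnsat (C : Clause V) : AllRedundant X q (processUnsat X q C Ω) := by
  intro x hx
  simp only [processUnsat]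
  split_ifs with h
  · simp
  · exact fun e => h ⟨hx, e⟩

theorem ActiveAt.after_processUnsat (hΩ : ActiveAt P X F q Ω) {C : Clause V} (hC : C ∈ F)
    (hf : falsifier C ⊆ q) : ActiveAt P X F q (processUnsat X q C Ω) := by
  intro x s hs
  simp only [processUnsat] at hs
  split_ifs at hs with h
  · obtain ⟨hxX, hxq⟩ := Finset.mem_sdiff.1 h.1
    obtain rfl := Option.some.inj hs
    exact ⟨hxX, hxq, hf, Or.inr ⟨C, hC, rfl⟩⟩
  · exact hΩ x s hs

theorem eq_of_mem_of_mem {V ι : Type*} {P : ι → Finset V}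
    (hP : ∀ i j, i ≠ j → Disjoint (P i) (P j)) {i j : ι} {x : V}
    (hi : x ∈ P i) (hj : x ∈ P j) : i = j := by
  by_contra h
  exact Finset.disjoint_left.1 (hP i j h) hi hj

/-- If no clause is falsified, the atomic D-sequent of a blocked variable is local: two clauses that
can be resolved on `x` lie in the component of `x`. -/
theorem BlockedReason.isLocal (hP : ∀ i j, i ≠ j → Disjoint (P i) (P j)) (hF : Split P F)
    (hΩ : ActiveAt P X F q Ω) (hq : ¬ Conflict F q) {x : V} (hx : ∃ i, x ∈ P i)
    {s : Assignment V} (h : BlockedReason F q Ω x s) : s ⊆ q ∧ IsLocal P s x := by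
  obtain ⟨ρ, hρ, hs⟩ := h
  obtain ⟨i, hi⟩ := hx
  have key : ∀ l ∈ s, l ∈ q ∧ l.1 ∈ P i := by
    intro l hl
    obtain ⟨A, hA, B, hB, hR, hl⟩ := (hs l).1 hl
    have hcomp : ∀ C ∈ F, ∀ b, (x, b) ∈ C → vars C ⊆ P i := by
      intro C hC b hb
      obtain ⟨j, hj⟩ := hF C hC
      rwa [eq_of_mem_of_mem hP hi (hj (mem_vars.2 ⟨b, hb⟩))]
    obtain ⟨b, hbA, hbB⟩ := hR.1
    have hAi := hcomp A hA _ hbA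
    have hBi := hcomp B hB _ hbB
    rcases hρ A hA B hB hR with ⟨m, hm, hmq, e⟩ | ⟨y, hy, hr⟩
    · rw [e, Finset.mem_singleton] at hl
      subst hl
      refine ⟨hmq, ?_⟩
      rcases Finset.mem_union.1 hm with hm | hm
      exacts [hAi (mem_vars.2 ⟨_, hm⟩), hBi (mem_vars.2 ⟨_, hm⟩)]
    · obtain ⟨-, -, hrq, ho⟩ := hΩ y _ hr
      obtain ⟨j, hyj, hrj⟩ := ho.isLocal hrq hq
      have hyi : y ∈ P i := (Finset.mem_union.1 hy).elim (fun h => hAi h) fun h => hBi h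
      obtain rfl := eq_of_mem_of_mem hP hyi hyj
      exact ⟨hrq hl, hrj (mem_vars.2 ⟨_, hl⟩)⟩
  refine ⟨fun l hl => (key l hl).1, i, hi, fun v hv => ?_⟩
  obtain ⟨b, hb⟩ := mem_vars.1 hv
  exact (key _ hb).2

theorem ActiveAt.update_blocked (hP : ∀ i j, i ≠ j → Disjoint (P i) (P j))
    (hX : ∀ x ∈ X, ∃ i, x ∈ P i) (hF : Split P F) (hΩ : ActiveAt P X F q Ω)
    (hq : ¬ Conflict F q) {x : V} (hx : x ∈ X) (hxq : x ∉ vars q) {s : Assignment V}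
    (h : BlockedReason F q Ω x s) : ActiveAt P X F q (Function.update Ω x (some s)) := by
  intro y t ht
  rcases eq_or_ne y x with rfl | hne
  · rw [Function.update_self] at ht
    obtain rfl := Option.some.inj ht
    have := h.isLocal hP hF hΩ hq (hX y hx)
    exact ⟨hx, hxq, this.1, Or.inl this.2⟩
  · rw [Function.update_of_ne hne] at ht
    exact hΩ y t ht

theorem extends_update {x : V} (hx : Ω x = none) (s : Assignment V) :
    Extends Ω (Function.update Ω x (some s)) := by
  intro y t ht
  rw [Function.update_of_ne (by rintro rfl; simp [hx] at ht), ht]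

theorem BlockedPhase.activeAt_extends (hP : ∀ i j, i ≠ j → Disjoint (P i) (P j))
    (hX : ∀ x ∈ X, ∃ i, x ∈ P i) (hF : Split P F) (hΩ : ActiveAt P X F q Ω)
    (hq : ¬ Conflict F q) (h : BlockedPhase X F q Ω Ω') :
    ActiveAt P X F q Ω' ∧ Extends Ω Ω' := by
  obtain ⟨h, -⟩ := h
  induction h with
  | refl => exact ⟨hΩ, fun _ _ h => h⟩
  | tail _ hstep ih =>
    obtain ⟨x, hx, s, hnone, -, hr, rfl⟩ := hstep
    obtain ⟨hxX, hxq⟩ := Finset.mem_sdiff.1 hx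
    exact ⟨ih.1.update_blocked hP hX hF hq hxX hxq hr, ih.2.trans (extends_update hnone s)⟩

theorem ActiveAt.insert_of_none {v : V} (hΩ : ActiveAt P X F q Ω) (hv : Ω v = none) (b : Bool) :
    ActiveAt P X F (insert (v, b) q) Ω := by
  intro x s hs
  obtain ⟨h₁, h₂, h₃, h₄⟩ := hΩ x s hs
  refine ⟨h₁, ?_, h₃.trans (Finset.subset_insert _ _), h₄⟩
  rw [vars_insert, Finset.mem_insert]
  rintro (rfl | h)
  exacts [by simp [hv] at hs, h₂ h]

theorem dropAsym_eq_some {v x : V} {s : Assignment V} :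
    dropAsym v Ω x = some s ↔ Ω x = some s ∧ v ∉ vars s := by
  simp [dropAsym, Option.filter_eq_some_iff]

theorem ActiveAt.eq_none {v : V} {b : Bool} (hΩ : ActiveAt P X F (insert (v, b) q) Ω) :
    Ω v = none := by
  rw [Option.eq_none_iff_forall_ne_some]
  intro s hs
  exact (hΩ v s hs).2.1 (by simp [vars_insert])

theorem ActiveAt.of_insert {v : V} {b : Bool} (hΩ : ActiveAt P X F (insert (v, b) q) Ω)
    (hs : ∀ x s, Ω x = some s → v ∉ vars s) : ActiveAt P X F q Ω := by
  intro x s h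
  obtain ⟨h₁, h₂, h₃, h₄⟩ := hΩ x s h
  rw [vars_insert, Finset.mem_insert, not_or] at h₂
  exact ⟨h₁, h₂.2, subset_of_subset_insert h₃ (hs x s h), h₄⟩

theorem ActiveAt.after_dropAsym {v : V} {b : Bool} (hΩ : ActiveAt P X F (insert (v, b) q) Ω) :
    ActiveAt P X F q (dropAsym v Ω) :=
  ActiveAt.of_insert (b := b) (fun x s h => hΩ x s (dropAsym_eq_some.1 h).1)
    fun _ _ h => (dropAsym_eq_some.1 h).2

/-- The D-sequents that are active at `q` survive the removal of those that depend on a variable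
not assigned by `q`. -/
theorem Extends.after_dropAsym {v : V} (h : Extends Ω Ω') (hΩ : ActiveAt P X F q Ω)
    (hv : v ∉ vars q) : Extends Ω (dropAsym v Ω') := fun x s hs =>
  dropAsym_eq_some.2 ⟨h x s hs, fun hvs => hv (vars_mono (hΩ x s hs).2.2.1 hvs)⟩

theorem AddBranchVar.activeAt (hP : ∀ i j, i ≠ j → Disjoint (P i) (P j))
    (hX : ∀ x ∈ X, ∃ i, x ∈ P i) (hF : Split P F) (hΩ : ActiveAt P X F q Ω)
    (hq : ¬ Conflict F q) {v : V} (hv : v ∉ vars q) (h : AddBranchVar X F q v Ω Ω') :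
    ActiveAt P X F q Ω' := by
  rcases h with ⟨-, rfl⟩ | ⟨hvX, s, hs, rfl⟩
  · exact hΩ
  · exact hΩ.update_blocked hP hX hF hq hvX hv hs

theorem AddBranchVar.extends {v : V} (hv : Ω v = none) (h : AddBranchVar X F q v Ω Ω') :
    Extends Ω Ω' := by
  rcases h with ⟨-, rfl⟩ | ⟨-, s, -, rfl⟩
  · exact fun _ _ h => h
  · exact extends_update hv s

theorem AddBranchVar.allRedundant {v : V} {b : Bool} (h : AddBranchVar X F q v Ω Ω')
    (hΩ : AllRedundant X (insert (v, b) q) Ω) : AllRedundant X q Ω' := by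
  intro x hx
  obtain ⟨hxX, hxq⟩ := Finset.mem_sdiff.1 hx
  have hne : x ≠ v → Ω x ≠ none := fun hne =>
    hΩ x (by simp [vars_insert, hxX, hxq, hne])
  rcases h with ⟨hvX, rfl⟩ | ⟨-, s, -, rfl⟩
  · exact hne fun e => hvX (e ▸ hxX)
  · rcases eq_or_ne x v with rfl | hxv
    · simp
    · rw [Function.update_of_ne hxv]
      exact hne hxv

/-- The join of two D-sequents is local. One of the branches has no falsified clause, so that its
D-sequent is local, and the other one, if it comes from a falsified clause, has the branching
variable and thus is in the same component. -/
theorem isLocal_resolveAt (hP : ∀ i j, i ≠ j → Disjoint (P i) (P j)) (hF : Split P F)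
    {v x : V} {b c : Bool} {s₀ s₁ : Assignment V}
    (hsat : ¬ (Conflict F (insert (v, b) q) ∧ Conflict F (insert (v, c) q)))
    (h₀ : s₀ ⊆ insert (v, b) q) (ho₀ : Origin P F s₀ x)
    (h₁ : s₁ ⊆ insert (v, c) q) (ho₁ : Origin P F s₁ x)
    (hv₀ : v ∈ vars s₀) (hv₁ : v ∈ vars s₁ ∨ ¬ Conflict F (insert (v, b) q)) :
    IsLocal P (resolveAt v s₀ s₁) x := by
  have of_same : ∀ s t, IsLocal P s x → v ∈ vars s → v ∈ vars t → Origin P F t x →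
      IsLocal P t x := by
    rintro s t ⟨i, hi, hs⟩ hvs hvt (h | ⟨C, hC, rfl⟩)
    · exact h
    · obtain ⟨j, hj⟩ := hF C hC
      rw [vars_falsifier] at hvt
      obtain rfl := eq_of_mem_of_mem hP (hs hvs) (hj hvt)
      exact ⟨i, hi, by rwa [vars_falsifier]⟩
  have hl : IsLocal P s₀ x ∧ IsLocal P s₁ x := by
    by_cases hc : Conflict F (insert (v, b) q)
    · have hl₁ := ho₁.isLocal h₁ fun h => hsat ⟨hc, h⟩
      have hv₁ := hv₁.resolve_right (not_not.2 hc)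
      exact ⟨of_same s₁ s₀ hl₁ hv₁ hv₀ ho₀, hl₁⟩
    · have hl₀ := ho₀.isLocal h₀ hc
      by_cases hv : v ∈ vars s₁
      · exact ⟨hl₀, of_same s₀ s₁ hl₀ hv₀ hv ho₁⟩
      · exact ⟨hl₀, ho₁.isLocal (subset_of_subset_insert h₁ hv) fun h =>
          hc (h.mono subset_rfl (Finset.subset_insert _ _))⟩
  obtain ⟨⟨i, hi, hs₀⟩, j, hj, hs₁⟩ := hl
  obtain rfl := eq_of_mem_of_mem hP hi hj
  refine ⟨i, hi, (vars_mono (Finset.filter_subset _ _)).trans fun w hw => ?_⟩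
  obtain ⟨d, hd⟩ := mem_vars.1 hw
  rcases Finset.mem_union.1 hd with hd | hd
  exacts [hs₀ (mem_vars.2 ⟨d, hd⟩), hs₁ (mem_vars.2 ⟨d, hd⟩)]

theorem joinDSeqs_some {v x : V} {q₀ : Assignment V} {s₀ s₁ : Assignment V} (h₀ : Ω x = some s₀)
    (h₁ : Ω' x = some s₁) :
    joinDSeqs F q₀ v Ω Ω' x =
      if v ∈ vars s₀ ∧ (v ∈ vars s₁ ∨ ¬ Conflict F q₀) then some (resolveAt v s₀ s₁)
        else some s₁ := by
  simp only [joinDSeqs, h₀, h₁]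

theorem joinDSeqs_none {v x : V} {q₀ : Assignment V} (h₁ : Ω' x = none) :
    joinDSeqs F q₀ v Ω Ω' x = none := by
  simp only [joinDSeqs, h₁]
  split <;> simp_all

theorem Extends.after_joinDSeqs {v : V} {q₀ : Assignment V} {Ω₀ Ω₁ : Active V}
    (h₀ : Extends Ω (dropAsym v Ω₀)) (h₁ : Extends Ω Ω₁) :
    Extends Ω (joinDSeqs F q₀ v Ω₀ Ω₁) := by
  intro x s hs
  obtain ⟨e, hv⟩ := dropAsym_eq_some.1 (h₀ x s hs)
  rw [joinDSeqs_some e (h₁ x s hs), if_neg fun h => hv h.1]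

theorem AllRedundant.after_joinDSeqs {v : V} {b c : Bool} {q₀ : Assignment V}
    (h₀ : AllRedundant X (insert (v, b) q) Ω) (h₁ : AllRedundant X (insert (v, c) q) Ω') :
    AllRedundant X (insert (v, b) q) (joinDSeqs F q₀ v Ω Ω') := by
  intro x hx
  obtain ⟨s₀, e₀⟩ := Option.ne_none_iff_exists'.1 (h₀ x hx)
  obtain ⟨s₁, e₁⟩ := Option.ne_none_iff_exists'.1 (h₁ x (by rwa [vars_insert] at hx ⊢))
  rw [joinDSeqs_some e₀ e₁]
  split_ifs <;> simp

/-- The D-sequents joined at `v` are active at `q`. For a D-sequent of the second branch that is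
kept this holds because a D-sequent of the first branch symmetric in `v` is still there after the
second one (`hext`). -/
theorem ActiveAt.after_joinDSeqs (hP : ∀ i j, i ≠ j → Disjoint (P i) (P j)) (hF : Split P F)
    {v : V} {b c : Bool}
    (hsat : ¬ (Conflict F (insert (v, b) q) ∧ Conflict F (insert (v, c) q)))
    (h₀ : ActiveAt P X F (insert (v, b) q) Ω) (h₁ : ActiveAt P X F (insert (v, c) q) Ω')
    (hall : AllRedundant X (insert (v, b) q) Ω) (hext : Extends (dropAsym v Ω) Ω') :
    ActiveAt P X F q (joinDSeqs F (insert (v, b) q) v Ω Ω') := by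
  intro x s hs
  cases e₁ : Ω' x with
  | none => simp [joinDSeqs_none e₁] at hs
  | some s₁ =>
    obtain ⟨hxX, hxq, hs₁, ho₁⟩ := h₁ x s₁ e₁
    rw [vars_insert, Finset.mem_insert, not_or] at hxq
    obtain ⟨s₀, e₀⟩ := Option.ne_none_iff_exists'.1
      (hall x (by simp [vars_insert, hxX, hxq]))
    obtain ⟨-, -, hs₀, ho₀⟩ := h₀ x s₀ e₀
    rw [joinDSeqs_some e₀ e₁] at hs
    refine ⟨hxX, hxq.2, ?_⟩
    split_ifs at hs with hc
    · obtain rfl := Option.some.inj hs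
      exact ⟨resolveAt_subset hs₀ hs₁,
        Or.inl (isLocal_resolveAt hP hF hsat hs₀ ho₀ hs₁ ho₁ hc.1 hc.2)⟩
    · obtain rfl := Option.some.inj hs
      refine ⟨subset_of_subset_insert hs₁ fun hv => ?_, ho₁⟩
      have hv₀ : v ∉ vars s₀ := fun h => hc ⟨h, Or.inl hv⟩
      have := (hext x s₀ (dropAsym_eq_some.2 ⟨e₀, hv₀⟩)).symm.trans e₁
      exact hv₀ (Option.some.inj this ▸ hv)

end Invariant

/-! ### Items: clauses and local D-sequents -/

section Items

variable {V ι : Type*} [DecidableEq V]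

open Classical in
/-- The number of items of a state: clauses that are not tautologies, and local D-sequents that have
been derived. -/
noncomputable def numItems (P : ι → Finset V) (σ : State V) : ℕ :=
  (σ.cnf.filter Functional).card + (σ.derived.filter fun p => IsLocal P p.1 p.2).card

variable {P : ι → Finset V} {X : Finset V} {q : Assignment V}

theorem numItems_mono {σ σ' : State V} (hF : σ.cnf ⊆ σ'.cnf) (hD : σ.derived ⊆ σ'.derived) :
    numItems P σ ≤ numItems P σ' := by
  classical
  exact Nat.add_le_add (Finset.card_le_card (Finset.filter_subset_filter _ hF))
    (Finset.card_le_card (Finset.filter_subset_filter _ hD))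

/-- If no clause was falsified at `q` and some variable had no active D-sequent, a state in which
all unassigned variables of `X` have D-sequents contains a new item: a clause falsified by `q` if
there is one now, and a D-sequent of that variable, which is then local, otherwise. -/
theorem numItems_lt (hq : Functional q) {F F' : CNF V} {D D' : Finset (Assignment V × V)}
    {Ω Ω' : Active V} (hF : F ⊆ F') (hD : D ⊆ keep X D' Ω') (hno : ¬ Conflict F q) {x : V}
    (hx : x ∈ X \ vars q) (hfresh : ∀ s, (s, x) ∈ D → ¬ s ⊆ q)
    (hΩ' : ActiveAt P X F' q Ω') (hall : AllRedundant X q Ω') :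
    numItems P ⟨F, D, Ω⟩ < numItems P ⟨F', keep X D' Ω', Ω'⟩ := by
  classical
  by_cases hc : Conflict F' q
  · obtain ⟨C, hC, hf⟩ := hc
    refine Nat.add_lt_add_of_lt_of_le (Finset.card_lt_card ?_)
      (Finset.card_le_card (Finset.filter_subset_filter _ hD))
    refine Finset.ssubset_iff_of_subset (Finset.filter_subset_filter _ hF) |>.2 ⟨C, ?_, ?_⟩
    · exact Finset.mem_filter.2 ⟨hC, functional_of_falsifier_subset hq hf⟩
    · exact fun h => hno ⟨C, (Finset.mem_filter.1 h).1, hf⟩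
  · obtain ⟨s, hs⟩ := Option.ne_none_iff_exists'.1 (hall x hx)
    obtain ⟨hxX, -, hsq, ho⟩ := hΩ' x s hs
    refine Nat.add_lt_add_of_le_of_lt (Finset.card_le_card (Finset.filter_subset_filter _ hF))
      (Finset.card_lt_card ?_)
    refine Finset.ssubset_iff_of_subset (Finset.filter_subset_filter _ hD) |>.2 ⟨(s, x), ?_, ?_⟩
    · exact Finset.mem_filter.2 ⟨mem_keep.2 (Or.inr ⟨hxX, hs⟩), ho.isLocal hsq hc⟩
    · exact fun h => hfresh s (Finset.mem_filter.1 h).1 hsq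

/-- There are fewer items than pairs of an index `i` and either a set of literals over the component
`i` or such a set together with a variable of `X` in this component: no D-sequent assigns its own
variable. -/
theorem numItems_lt_sum {k : ℕ} {P : Fin k → Finset V} (hX : ∀ x ∈ X, ∃ i, x ∈ P i)
    (hne : X.Nonempty) {σ : State V} (h : Invariant P X q σ) :
    numItems P σ < ∑ i, 3 ^ (P i).card * ((X ∩ P i).card + 1) := by
  classical
  set A := Finset.univ.biUnion fun i => functionalSets (P i) with hA
  set B := Finset.univ.biUnion fun i => functionalSets (P i) ×ˢ (X ∩ P i) with hB
  have h₁ : (σ.cnf.filter Functional).card ≤ A.card := by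
    refine Finset.card_le_card fun C hC => ?_
    obtain ⟨hC, hf⟩ := Finset.mem_filter.1 hC
    obtain ⟨i, hi⟩ := h.split C hC
    exact Finset.mem_biUnion.2 ⟨i, Finset.mem_univ _, mem_functionalSets.2 ⟨hi, hf⟩⟩
  have h₂ : (σ.derived.filter fun p => IsLocal P p.1 p.2).card < B.card := by
    refine Finset.card_lt_card (Finset.ssubset_iff_of_subset ?_ |>.2 ?_)
    · rintro ⟨s, x⟩ hp
      obtain ⟨hp, i, hx, hs⟩ := Finset.mem_filter.1 hp
      have := h.proper s x hp
      exact Finset.mem_biUnion.2 ⟨i, Finset.mem_univ _, Finset.mem_product.2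
        ⟨mem_functionalSets.2 ⟨hs, this.functional⟩, Finset.mem_inter.2 ⟨this.mem, hx⟩⟩⟩
    · obtain ⟨x, hx⟩ := hne
      obtain ⟨i, hi⟩ := hX x hx
      refine ⟨({(x, true)}, x), ?_, fun hp => ?_⟩
      · refine Finset.mem_biUnion.2 ⟨i, Finset.mem_univ _, Finset.mem_product.2
          ⟨mem_functionalSets.2 ⟨by simpa [vars] using hi, ?_⟩, Finset.mem_inter.2 ⟨hx, hi⟩⟩⟩
        intro v b hv hv'
        simp_all
      · exact (h.proper _ _ (Finset.mem_filter.1 hp).1).notMem_vars (by simp [vars])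
  have h₃ : A.card + B.card ≤ ∑ i, 3 ^ (P i).card * ((X ∩ P i).card + 1) := by
    refine (Nat.add_le_add Finset.card_biUnion_le Finset.card_biUnion_le).trans ?_
    rw [← Finset.sum_add_distrib]
    refine Finset.sum_le_sum fun i _ => ?_
    rw [Finset.card_product, add_comm, ← mul_add_one]
    exact Nat.mul_le_mul_right _ (card_functionalSets_le _)
  exact lt_of_lt_of_le (Nat.add_lt_add_of_le_of_lt h₁ h₂) h₃

end Items

/-! ### Counting the inner nodes -/

/-- The number of nodes that are not leaves. -/
def SearchTree.inner {V : Type*} : SearchTree V → ℕ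
  | .leaf => 0
  | .one _ _ t => t.inner + 1
  | .two _ _ t₀ t₁ => t₀.inner + t₁.inner + 1

theorem SearchTree.size_le {V : Type*} (T : SearchTree V) : T.size ≤ 2 * T.inner + 1 := by
  induction T with
  | leaf => simp [size, inner]
  | one v b t ih => simp only [size, inner]; omega
  | two v b t₀ t₁ ih₀ ih₁ => simp only [size, inner]; omega

section Count

variable {V ι : Type*} [DecidableEq V] {P : ι → Finset V} {X : Finset V} {q : Assignment V}

/-- What holds for the states before and after a call at `q`. -/
structure CallSpec (P : ι → Finset V) (X : Finset V) (q : Assignment V) (σ σ' : State V) :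
    Prop where
  inv : Invariant P X q σ'
  cnf_subset : σ.cnf ⊆ σ'.cnf
  derived_subset : σ.derived ⊆ σ'.derived
  allRedundant : AllRedundant X q σ'.active
  extend : Extends σ.active σ'.active

theorem subset_keep {D : Finset (Assignment V × V)} {Ω : Active V} : D ⊆ keep X D Ω :=
  Finset.subset_union_left

theorem numItems_keep_le {F : CNF V} {D : Finset (Assignment V × V)} {Ω Ω' Ω'' : Active V} :
    numItems P ⟨F, D, Ω⟩ ≤ numItems P ⟨F, keep X D Ω', Ω''⟩ :=
  numItems_mono subset_rfl subset_keep

/-- The D-sequents of the first branch that do not depend on `v` can be taken to the second one. -/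
theorem Invariant.second {v : V} {b : Bool} (c : Bool) {F : CNF V}
    {D : Finset (Assignment V × V)} {Ω : Active V}
    (h : Invariant P X (insert (v, b) q) ⟨F, D, Ω⟩) :
    Invariant P X (insert (v, c) q) ⟨F, D, dropAsym v Ω⟩ where
  split := h.split
  proper := h.proper
  activeAt := h.activeAt.after_dropAsym.insert_of_none
    (by rw [dropAsym, h.activeAt.eq_none]; rfl) c

/-- What holds when a node at `q` starts to branch on `v`: in particular some variable `x` of `X`
has had no active D-sequent. -/
structure Branching (P : ι → Finset V) (X : Finset V) (q : Assignment V) (F : CNF V)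
    (D : Finset (Assignment V × V)) (Ω Ω₂ : Active V) (v : V) : Prop where
  unassigned : v ∉ vars q
  component : ∃ i, v ∈ P i
  extend : Extends Ω Ω₂
  activeAt : ActiveAt P X F q Ω₂
  inv : ∀ b, Invariant P X (insert (v, b) q) ⟨F, keep X D Ω₂, Ω₂⟩
  fresh : ∃ x ∈ X \ vars q, ∀ s, (s, x) ∈ D → ¬ s ⊆ q

theorem Branching.of_pick (hP : ∀ i j, i ≠ j → Disjoint (P i) (P j))
    (hX : ∀ x ∈ X, ∃ i, x ∈ P i) (hq : Functional q) {F : CNF V}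
    {D : Finset (Assignment V × V)} {Ω Ω₁ Ω₂ : Active V} {v : V} {b : Bool}
    (hinv : Invariant P X q ⟨F, D, Ω⟩) (hreuse : Reuse X q D Ω Ω₁) (hno : ¬ Conflict F q)
    (hblocked : BlockedPhase X F q Ω₁ Ω₂) (hall : ¬ AllRedundant X q Ω₂)
    (hpick : Pick X F q Ω₂ v b) : Branching P X q F D Ω Ω₂ v := by
  obtain ⟨hΩ₂, hext⟩ := hblocked.activeAt_extends hP hX hinv.split
    (hreuse.activeAt hinv.activeAt hinv.proper) hno
  have hv : v ∉ vars q ∧ Ω₂ v = none ∧ ∃ i, v ∈ P i := by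
    rcases hpick.1 with ⟨hvF, hvq, -⟩ | ⟨hv, hnone, -⟩
    · obtain ⟨hvF, hvX⟩ := Finset.mem_sdiff.1 hvF
      refine ⟨hvq, ?_, ?_⟩
      · rw [Option.eq_none_iff_forall_ne_some]
        exact fun s hs => hvX (hΩ₂ v s hs).1
      · obtain ⟨C, hC, hvC⟩ := Finset.mem_biUnion.1 hvF
        obtain ⟨i, hi⟩ := hinv.split C hC
        exact ⟨i, hi hvC⟩
    · obtain ⟨hvX, hvq⟩ := Finset.mem_sdiff.1 hv
      exact ⟨hvq, hnone, hX v hvX⟩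
  refine ⟨hv.1, hv.2.2, hreuse.extends.trans hext, hΩ₂, fun c => ?_, ?_⟩
  · exact .of_keep (hq.insert_of_notMem hv.1 c) hinv.split hinv.proper (hΩ₂.insert_of_none hv.2.1 c)
  · simp only [AllRedundant, not_forall, not_not] at hall
    obtain ⟨x, hx, hnone⟩ := hall
    have none_of : ∀ {Ω Ω' : Active V}, Extends Ω Ω' → Ω' x = none → Ω x = none := by
      intro Ω Ω' h h'
      rw [Option.eq_none_iff_forall_ne_some]
      intro s hs
      simp [h x s hs] at h'
    have h₁ := none_of hext hnone
    have hr := hreuse x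
    rw [if_pos ⟨hx, none_of hreuse.extends h₁⟩] at hr
    rcases hr with ⟨s, -, -, e⟩ | ⟨h, -⟩
    · simp [h₁] at e
    · exact ⟨x, hx, h⟩

theorem split_insert_resolvent (hP : ∀ i j, i ≠ j → Disjoint (P i) (P j)) {F : CNF V}
    (hF : Split P F) {C₀ C₁ C : Clause V} {v : V} (hC₀ : C₀ ∈ F) (hC₁ : C₁ ∈ F)
    (h : ResolveClauses C₀ C₁ v C) : Split P (insert C F) := by
  intro A hA
  rcases Finset.mem_insert.1 hA with rfl | hA
  · rcases h with ⟨-, rfl⟩ | ⟨-, rfl⟩ | ⟨h₀, h₁, rfl⟩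
    · exact hF _ hC₀
    · exact hF _ hC₁
    · obtain ⟨i, hi⟩ := hF _ hC₀
      obtain ⟨j, hj⟩ := hF _ hC₁
      obtain rfl := eq_of_mem_of_mem hP (hi h₀) (hj h₁)
      refine ⟨i, (vars_mono (Finset.filter_subset _ _)).trans ?_⟩
      rw [vars, Finset.image_union]
      exact Finset.union_subset hi hj
  · exact hF A hA

theorem falsifier_resolvent_subset {C₀ C₁ C : Clause V} {v : V} {b c : Bool}
    (h₀ : falsifier C₀ ⊆ insert (v, b) q) (h₁ : falsifier C₁ ⊆ insert (v, c) q)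
    (h : ResolveClauses C₀ C₁ v C) : falsifier C ⊆ q := by
  rcases h with ⟨hv, rfl⟩ | ⟨hv, rfl⟩ | ⟨-, -, rfl⟩
  · exact subset_of_subset_insert h₀ (by rwa [vars_falsifier])
  · exact subset_of_subset_insert h₁ (by rwa [vars_falsifier])
  · rw [falsifier_resolveAt]
    exact resolveAt_subset h₀ h₁

/-- The induction step of the count at an inner node with `i` inner nodes below it, `e` unassigned
variables after branching, and `m`, `m'` items before and after the call. The branches take the
items from `a` to `b`, and the additional node is paid for by the new item. -/
theorem inner_count_step {i e m a b c m' : ℕ} (h₀ : i + e * a ≤ e * b) (hm : m ≤ a)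
    (hb : b ≤ c) (hc : c ≤ m') (hlt : m < m') : i + 1 + (e + 1) * m ≤ (e + 1) * m' := by
  have h₁ := Nat.mul_le_mul_left e hm
  have h₂ := Nat.mul_le_mul_left e (hb.trans hc)
  rw [add_one_mul, add_one_mul]
  omega

/-- A call at `q` preserves the invariant, and its number of inner nodes is at most the number of
unassigned variables times the number of items that it creates: the inner nodes to which the same
new item is charged lie on one path and branch on different unassigned variables. -/
theorem Run.inner_add_le (hP : ∀ i j, i ≠ j → Disjoint (P i) (P j))
    (hX : ∀ x ∈ X, ∃ i, x ∈ P i) {W : Finset V} (hW : ∀ i, P i ⊆ W) {σ σ' : State V}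
    {T : SearchTree V} (hrun : Run X q σ T σ') (hq : Functional q) (hinv : Invariant P X q σ) :
    CallSpec P X q σ σ' ∧
      T.inner + (W \ vars q).card * numItems P σ ≤ (W \ vars q).card * numItems P σ' := by
  have hcard : ∀ {q : Assignment V} {v : V} (b : Bool), v ∉ vars q → (∃ i, v ∈ P i) →
      (W \ vars q).card = (W \ vars (insert (v, b) q)).card + 1 := by
    rintro q v b hv ⟨i, hi⟩
    rw [vars_insert, Finset.sdiff_insert, Finset.card_erase_add_one]
    exact Finset.mem_sdiff.2 ⟨hW i hi, hv⟩
  have hsum : ∀ {i₀ i₁ a b c : ℕ}, i₀ + a ≤ b → i₁ + b ≤ c → i₀ + i₁ + a ≤ c := by omega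
  induction hrun with
  | unsatLeaf q F D Ω Ω₁ C hreuse hC hfals =>
    refine ⟨⟨?_, subset_rfl, subset_keep, allRedundant_processUnsat C,
      hreuse.extends.trans (extends_processUnsat C)⟩, ?_⟩
    · exact .of_keep hq hinv.split hinv.proper
        ((hreuse.activeAt hinv.activeAt hinv.proper).after_processUnsat hC hfals)
    · simpa [SearchTree.inner] using
        Nat.mul_le_mul_left _ (numItems_keep_le (P := P) (F := F) (D := D))
  | satLeaf q F D Ω Ω₁ Ω₂ hreuse hno hblocked hall =>
    obtain ⟨hΩ₂, hext⟩ := hblocked.activeAt_extends hP hX hinv.split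
      (hreuse.activeAt hinv.activeAt hinv.proper) hno
    refine ⟨⟨.of_keep hq hinv.split hinv.proper hΩ₂, subset_rfl, subset_keep, hall,
      hreuse.extends.trans hext⟩, ?_⟩
    simpa [SearchTree.inner] using
      Nat.mul_le_mul_left _ (numItems_keep_le (P := P) (F := F) (D := D))
  | oneBranch q F F₀ D D₀ Ω Ω₁ Ω₂ Ω₃ Ω₄ v b t hreuse hno hblocked hall hpick hfirst hsym hskip
      hret ih =>
    have hB := Branching.of_pick hP hX hq hinv hreuse hno hblocked hall hpick
    obtain ⟨x, hx, hfresh⟩ := hB.fresh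
    obtain ⟨spec, hle⟩ := ih (hq.insert_of_notMem hB.unassigned b) (hB.inv b)
    have hΩ₃ : ActiveAt P X F₀ q Ω₃ := spec.inv.activeAt.of_insert hsym
    have hret' : ActiveAt P X F₀ q Ω₄ ∧ AllRedundant X q Ω₄ ∧ Extends Ω₃ Ω₄ := by
      rcases hret with ⟨C, hC, hf, rfl⟩ | ⟨hno', hadd⟩
      · exact ⟨hΩ₃.after_processUnsat hC hf, allRedundant_processUnsat C, extends_processUnsat C⟩
      · exact ⟨hadd.activeAt hP hX spec.inv.split hΩ₃ hno' hB.unassigned,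
          hadd.allRedundant spec.allRedundant, hadd.extends spec.inv.activeAt.eq_none⟩
    have hD : D ⊆ keep X D₀ Ω₄ := (subset_keep.trans spec.derived_subset).trans subset_keep
    refine ⟨⟨.of_keep hq spec.inv.split spec.inv.proper hret'.1, spec.cnf_subset, hD, hret'.2.1,
      (hB.extend.trans spec.extend).trans hret'.2.2⟩, ?_⟩
    have hlt := numItems_lt (Ω := Ω) hq spec.cnf_subset hD hno hx hfresh hret'.1 hret'.2.1
    rw [hcard b hB.unassigned hB.component, SearchTree.inner]
    exact inner_count_step hle numItems_keep_le le_rfl numItems_keep_le hlt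
  | bothUnsat q F F₀ F₁ D D₀ D₁ Ω Ω₁ Ω₂ Ω₃ Ω₄ v b t₀ t₁ C₀ C₁ C hreuse hno hblocked hall hpick
      hfirst hcont hsecond hC₀ hfals₀ hC₁ hfals₁ hres ih₀ ih₁ =>
    have hB := Branching.of_pick hP hX hq hinv hreuse hno hblocked hall hpick
    obtain ⟨x, hx, hfresh⟩ := hB.fresh
    obtain ⟨spec₀, hle₀⟩ := ih₀ (hq.insert_of_notMem hB.unassigned b) (hB.inv b)
    obtain ⟨spec₁, hle₁⟩ := ih₁ (hq.insert_of_notMem hB.unassigned _) (spec₀.inv.second _)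
    have hF₁ : F₁ ⊆ insert C F₁ := Finset.subset_insert _ _
    have hF : F ⊆ insert C F₁ := (spec₀.cnf_subset.trans spec₁.cnf_subset).trans hF₁
    have hD : D ⊆ keep X D₁ (processUnsat X q C (dropAsym v Ω₄)) :=
      ((subset_keep.trans spec₀.derived_subset).trans spec₁.derived_subset).trans subset_keep
    have hact : ActiveAt P X (insert C F₁) q (processUnsat X q C (dropAsym v Ω₄)) :=
      (spec₁.inv.activeAt.after_dropAsym.mono hF₁).after_processUnsat
        (Finset.mem_insert_self _ _) (falsifier_resolvent_subset hfals₀ hfals₁ hres)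
    have hred := allRedundant_processUnsat (X := X) (q := q) (Ω := dropAsym v Ω₄) C
    have hext : Extends Ω (dropAsym v Ω₄) :=
      hB.extend.trans ((((spec₀.extend.after_dropAsym hB.activeAt hB.unassigned).trans
        spec₁.extend)).after_dropAsym hB.activeAt hB.unassigned)
    refine ⟨⟨.of_keep hq (split_insert_resolvent hP spec₁.inv.split hC₀ hC₁ hres)
      (fun s x h => (spec₁.inv.proper s x h).mono hF₁) hact, hF, hD, hred,
      hext.trans (extends_processUnsat C)⟩, ?_⟩
    have hlt := numItems_lt (Ω := Ω) hq hF hD hno hx hfresh hact hred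
    rw [hcard b hB.unassigned hB.component, SearchTree.inner]
    -- Both branches assign the same variables.
    rw [vars_insert, ← vars_insert v b] at hle₁
    exact inner_count_step (i := t₀.inner + t₁.inner) (hsum hle₀ hle₁) numItems_keep_le le_rfl
      (numItems_mono hF₁ subset_keep) hlt
  | merge q F F₀ F₁ D D₀ D₁ Ω Ω₁ Ω₂ Ω₃ Ω₄ Ω₅ v b t₀ t₁ hreuse hno hblocked hall hpick hfirst
      hcont hsecond hsat hadd ih₀ ih₁ =>
    have hB := Branching.of_pick hP hX hq hinv hreuse hno hblocked hall hpick
    obtain ⟨x, hx, hfresh⟩ := hB.fresh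
    obtain ⟨spec₀, hle₀⟩ := ih₀ (hq.insert_of_notMem hB.unassigned b) (hB.inv b)
    obtain ⟨spec₁, hle₁⟩ := ih₁ (hq.insert_of_notMem hB.unassigned _) (spec₀.inv.second _)
    have hF : F ⊆ F₁ := spec₀.cnf_subset.trans spec₁.cnf_subset
    have hD : D ⊆ keep X D₁ Ω₅ :=
      ((subset_keep.trans spec₀.derived_subset).trans spec₁.derived_subset).trans subset_keep
    have hno₁ : ¬ Conflict F₁ q := fun h => hsat
      ⟨h.mono subset_rfl (Finset.subset_insert _ _), h.mono subset_rfl (Finset.subset_insert _ _)⟩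
    have hjoin := ActiveAt.after_joinDSeqs hP spec₁.inv.split hsat
      (spec₀.inv.activeAt.mono spec₁.cnf_subset) spec₁.inv.activeAt spec₀.allRedundant spec₁.extend
    have hact := hadd.activeAt hP hX spec₁.inv.split hjoin hno₁ hB.unassigned
    have hred := hadd.allRedundant (spec₀.allRedundant.after_joinDSeqs spec₁.allRedundant)
    have hext₀ : Extends Ω₂ (dropAsym v Ω₃) :=
      spec₀.extend.after_dropAsym hB.activeAt hB.unassigned
    have hext : Extends Ω Ω₅ :=
      (hB.extend.trans (hext₀.after_joinDSeqs (hext₀.trans spec₁.extend))).trans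
        (hadd.extends (joinDSeqs_none spec₁.inv.activeAt.eq_none))
    refine ⟨⟨.of_keep hq spec₁.inv.split spec₁.inv.proper hact, hF, hD, hred, hext⟩, ?_⟩
    have hlt := numItems_lt (Ω := Ω) hq hF hD hno hx hfresh hact hred
    rw [hcard b hB.unassigned hB.component, SearchTree.inner]
    -- Both branches assign the same variables.
    rw [vars_insert, ← vars_insert v b] at hle₁
    exact inner_count_step (i := t₀.inner + t₁.inner) (hsum hle₀ hle₁) numItems_keep_le le_rfl numItems_keep_le hlt

theorem Run.inner_eq_zero {σ σ' : State V} {T : SearchTree V} (h : Run ∅ q σ T σ') :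
    T.inner = 0 := by
  cases h with
  | unsatLeaf | satLeaf => rfl
  | oneBranch | bothUnsat | merge =>
    exact absurd (by simp [AllRedundant]) ‹¬ AllRedundant ∅ q _›

end Count

end DDS

theorem mainTheorem2 {V : Type*} [DecidableEq V] (k : ℕ) (F : Fin k → DDS.CNF V) (X : Finset V)
    (hdisj : ∀ i j, i ≠ j → Disjoint (DDS.cnfVars (F i)) (DDS.cnfVars (F j)))
    (hX : X ⊆ DDS.cnfVars (Finset.univ.biUnion F))
    (hne : (DDS.cnfVars (Finset.univ.biUnion F)).Nonempty)
    (T : DDS.SearchTree V) (hT : DDS.IsSearchTree X (Finset.univ.biUnion F) T) :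
    T.size ≤ (DDS.cnfVars (Finset.univ.biUnion F)).card *
      ∑ i : Fin k,
        2 * 3 ^ ((X ∩ DDS.cnfVars (F i)) ∪ (DDS.cnfVars (F i) \ X)).card *
          ((X ∩ DDS.cnfVars (F i)).card + 1) := by
  obtain ⟨σ, hrun⟩ := hT
  have hunion : ∀ i, (X ∩ DDS.cnfVars (F i)) ∪ (DDS.cnfVars (F i) \ X) = DDS.cnfVars (F i) := by
    intro i
    rw [Finset.inter_comm, Finset.union_comm, Finset.sdiff_union_inter]
  simp only [hunion, mul_assoc, ← Finset.mul_sum]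
  have hcomp : ∀ x ∈ DDS.cnfVars (Finset.univ.biUnion F), ∃ i, x ∈ DDS.cnfVars (F i) := by
    intro x hx
    obtain ⟨C, hC, hx⟩ := Finset.mem_biUnion.1 hx
    obtain ⟨i, -, hC⟩ := Finset.mem_biUnion.1 hC
    exact ⟨i, DDS.vars_subset_cnfVars hC hx⟩
  have hW : ∀ i, DDS.cnfVars (F i) ⊆ DDS.cnfVars (Finset.univ.biUnion F) := fun i =>
    Finset.biUnion_subset_biUnion_of_subset_left _
      (Finset.subset_biUnion_of_mem F (Finset.mem_univ i))
  have hinv : DDS.Invariant (fun i => DDS.cnfVars (F i)) X ∅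
      ⟨Finset.univ.biUnion F, ∅, fun _ => none⟩ := by
    refine ⟨fun C hC => ?_, by simp, by simp [DDS.ActiveAt]⟩
    obtain ⟨i, -, hC⟩ := Finset.mem_biUnion.1 hC
    exact ⟨i, DDS.vars_subset_cnfVars hC⟩
  obtain ⟨spec, hle⟩ := hrun.inner_add_le hdisj (fun x hx => hcomp x (hX hx)) hW
    (by simp [DDS.Functional]) hinv
  have hpos := hne.card_pos
  simp only [DDS.vars, Finset.image_empty, Finset.sdiff_empty] at hle
  set n := (DDS.cnfVars (Finset.univ.biUnion F)).card
  set N := ∑ i, 3 ^ (DDS.cnfVars (F i)).card * ((X ∩ DDS.cnfVars (F i)).card + 1)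
  have hsize := T.size_le
  rcases X.eq_empty_or_nonempty with hXe | hXne
  · -- Nothing is quantified, so the root is a leaf.
    have hleaf : T.inner = 0 := by
      subst hXe
      exact hrun.inner_eq_zero
    obtain ⟨x, hx⟩ := hne
    obtain ⟨i, -⟩ := hcomp x hx
    have hNpos : 0 < N := Finset.sum_pos (fun i _ => by positivity) ⟨i, Finset.mem_univ i⟩
    have := Nat.mul_pos hpos hNpos
    rw [Nat.mul_left_comm]
    omega
  · have hlt : _ < N := DDS.numItems_lt_sum (fun x hx => hcomp x (hX hx)) hXne spec.inv
    -- One inner node per variable is to spare; it makes up for the last leaf in `hsize`.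
    have := Nat.mul_le_mul_left n (Nat.succ_le_of_lt hlt)
    rw [Nat.mul_succ] at this
    rw [Nat.mul_left_comm]
    omega
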